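/- Let $n\ge 1$, let $0=k_0<k_1<\dots<k_n=n^*$ be integers, and put $m_i=k_i-k_{i-1}$ for $1\le i\le n$, so that $m_i\ge 1$ and $\sum_{i=1}^n m_i=n^*$. Let $X_1,\dots,X_n$ be independent continuous real random variables (their distribution functions $F_{X_i}$ are continuous). Let $U_1,\dots,U_{n^*-1}$ be independent and uniformly distributed on $[0,1]$, independent of $(X_1,\dots,X_n)$, with order statistics $U_{(1)}\le\dots\le U_{(n^*-1)}$, and put $U_{(0)}=0$, $U_{(n^*)}=1$. Let $F$ be the distribution of the randomly weighted average $$S_{n^*}=\sum_{j=1}^n R_{k_j}X_j,\qquad R_{k_j}=U_{(k_j)}-U_{(k_{j-1})}.$$ For a probability distribution $H$ on $\mathbb{R}$ let $S(H,z)=\int_{\mathbb{R}}\frac{1}{z-x}\,H(dx)$ for $z\in\mathbb{C}\setminus\operatorname{supp}H$ denote its Stieltjes transform. Then for every complex number $z$ outside $\bigcup_{i=1}^n\operatorname{supp}F_{X_i}$ at which $S(F,\cdot)$ is defined, that is, with also $z\notin\operatorname{supp}F$, $$\frac{(-1)^{n^*-1}}{(n^*-1)!}\,\frac{d^{n^*-1}}{dz^{n^*-1}}S(F,z)=\prod_{i=1}^n\frac{(-1)^{m_i-1}}{(m_i-1)!}\,\frac{d^{m_i-1}}{dz^{m_i-1}}S(F_{X_i},z).$$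 -/

import Mathlib

open MeasureTheory ProbabilityTheory

/-- The order statistics `U_(0) ≤ U_(1) ≤ … ≤ U_(N) ≤ U_(N+1)` of a sample `u` of `N` points of
`[0,1]`, with the conventions `U_(0) = 0` and `U_(N+1) = 1`: for `1 ≤ k ≤ N`, `orderStat u k` is the
`k`-th smallest value of `u`. -/
noncomputable def orderStat {N : ℕ} (u : Fin N → ℝ) (k : ℕ) : ℝ :=
  if k = 0 then 0 else if h : k - 1 < N then u (Tuple.sort u ⟨k - 1, h⟩) else 1

/-- The weights `R_j = U_(k_j) - U_(k_{j-1})` cut out of `[0,1]` by the order statistics with indices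
`k_0, k_1, …, k_n`. -/
noncomputable def spacingWeight {N n : ℕ} (u : Fin N → ℝ) (k : Fin (n + 1) → ℕ) (j : Fin n) : ℝ :=
  orderStat u (k j.succ) - orderStat u (k j.castSucc)

/-- The randomly weighted average `∑ j, R_j x_j`. -/
noncomputable def weightedAverage {N n : ℕ} (u : Fin N → ℝ) (k : Fin (n + 1) → ℕ)
    (x : Fin n → ℝ) : ℝ :=
  ∑ j, spacingWeight u k j * x j

/-- The Stieltjes transform `S(H, z) = ∫ 1 / (z - x) H(dx)`, meant for `z` outside the support
of `H`. -/
noncomputable def stieltjes (H : Measure ℝ) (z : ℂ) : ℂ :=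
  ∫ x : ℝ, 1 / (z - (x : ℂ)) ∂H

/-- `stieltjes` is, up to sign, Mathlib's resolvent transform; in particular, for a finite measure,
the integrand is integrable for `z` outside the support, and the transform is holomorphic there. -/
theorem stieltjes_eq_neg_resolventTransform (H : Measure ℝ) (z : ℂ) :
    stieltjes H z = -resolventTransform H z := by
  rw [stieltjes, resolventTransform_apply, ← integral_neg]
  congr 1 with x
  rw [resolvent, Ring.inverse_eq_inv', ← inv_neg, one_div]
  simp

/-- The order statistics are measurable functions of the sample. -/
theorem measurable_orderStat {N : ℕ} (k : ℕ) :
    Measurable (fun u : Fin N → ℝ => orderStat u k) := by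
  unfold orderStat
  split_ifs with h0 h
  · exact measurable_const
  · refine measurable_of_Iic fun t => ?_
    have : (fun u : Fin N → ℝ => u (Tuple.sort u ⟨k - 1, h⟩)) ⁻¹' Set.Iic t =
        ⋃ σ : Equiv.Perm (Fin N), ⋂ i : Fin N, ⋂ _ : i ≤ ⟨k - 1, h⟩,
          {u : Fin N → ℝ | u (σ i) ≤ t} := by
      ext u
      simp only [Set.mem_preimage, Set.mem_Iic, Set.mem_iUnion, Set.mem_iInter, Set.mem_ofPred_eq]
      constructor
      · intro hu
        exact ⟨Tuple.sort u, fun i hi => (Tuple.monotone_sort u hi).trans hu⟩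
      · rintro ⟨σ, hσ⟩
        by_contra! hlt
        have hinj : (Finset.Iic (⟨k - 1, h⟩ : Fin N)).card ≤
            (Finset.Iio (⟨k - 1, h⟩ : Fin N)).card := by
          refine Finset.card_le_card_of_injOn (fun i => (Tuple.sort u).symm (σ i)) ?_
            (fun a _ b _ hab => σ.injective ((Tuple.sort u).symm.injective hab))
          intro i hi
          simp only [Finset.coe_Iic, Set.mem_Iic] at hi
          simp only [Finset.coe_Iio, Set.mem_Iio]
          by_contra! hge
          have := Tuple.monotone_sort u hge
          simp only [Function.comp_apply, Equiv.apply_symm_apply] at this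
          exact absurd (hσ i hi) (not_le.2 (hlt.trans_le this))
        simp at hinj
    rw [this]
    exact MeasurableSet.iUnion fun σ => MeasurableSet.iInter fun i => MeasurableSet.iInter fun _ =>
      measurableSet_le (measurable_pi_apply _) measurable_const
  · exact measurable_const

/-- The randomly weighted average is a random variable. -/
theorem measurable_weightedAverage {Ω : Type*} [MeasurableSpace Ω] {N n : ℕ}
    {U : Fin N → Ω → ℝ} {X : Fin n → Ω → ℝ} (hU : ∀ j, Measurable (U j))
    (hX : ∀ i, Measurable (X i)) (k : Fin (n + 1) → ℕ) :
    Measurable (fun ω => weightedAverage (fun j => U j ω) k (fun i => X i ω)) := by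
  have h : ∀ l, Measurable (fun ω => orderStat (fun j => U j ω) l) := fun l =>
    (measurable_orderStat l).comp (measurable_pi_lambda _ hU)
  unfold weightedAverage spacingWeight
  exact Finset.measurable_sum _ fun j _ => ((h _).sub (h _)).mul (hX j)

theorem abs_im_le_norm_sub_ofReal (z : ℂ) (x : ℝ) : |z.im| ≤ ‖z - (x : ℂ)‖ := by
  simpa using Complex.abs_im_le_norm (z - (x : ℂ))

theorem sub_ofReal_ne_zero {z : ℂ} (hz : z.im ≠ 0) (x : ℝ) : z - (x : ℂ) ≠ 0 :=
  norm_pos_iff.1 ((abs_pos.2 hz).trans_le (abs_im_le_norm_sub_ofReal z x))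

theorem norm_inv_sub_ofReal_pow_le {z : ℂ} {c : ℝ} (hc : 0 < c) (hz : c ≤ |z.im|) (x : ℝ) (n : ℕ) :
    ‖(z - (x : ℂ))⁻¹ ^ n‖ ≤ c⁻¹ ^ n := by
  rw [norm_pow, norm_inv]
  gcongr
  exact hz.trans (abs_im_le_norm_sub_ofReal z x)

theorem measurable_inv_sub_ofReal_pow (z : ℂ) (n : ℕ) :
    Measurable fun x : ℝ => (z - (x : ℂ))⁻¹ ^ n := by
  fun_prop

theorem integrable_inv_sub_ofReal_pow (H : Measure ℝ) [IsFiniteMeasure H] {z : ℂ} (hz : z.im ≠ 0)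
    (n : ℕ) : Integrable (fun x : ℝ => (z - (x : ℂ))⁻¹ ^ n) H :=
  Integrable.of_bound (measurable_inv_sub_ofReal_pow z n).aestronglyMeasurable _
    (Filter.Eventually.of_forall fun x =>
      norm_inv_sub_ofReal_pow_le (abs_pos.2 hz) le_rfl x n)

theorem hasDerivAt_integral_inv_sub_ofReal_pow (H : Measure ℝ) [IsFiniteMeasure H] {z : ℂ}
    (hz : z.im ≠ 0) (n : ℕ) :
    HasDerivAt (fun w : ℂ => ∫ x : ℝ, (w - (x : ℂ))⁻¹ ^ (n + 1) ∂H)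
      (-(n + 1) * ∫ x : ℝ, (z - (x : ℂ))⁻¹ ^ (n + 2) ∂H) z := by
  have hc : 0 < |z.im| / 2 := half_pos (abs_pos.2 hz)
  have him : ∀ w ∈ Metric.ball z (|z.im| / 2), |z.im| / 2 ≤ |w.im| := by
    intro w hw
    have h1 : |z.im - w.im| ≤ ‖z - w‖ := by simpa using Complex.abs_im_le_norm (z - w)
    have h2 : ‖z - w‖ < |z.im| / 2 := by simpa [dist_eq_norm, norm_sub_rev] using hw
    have h3 := abs_sub_abs_le_abs_sub z.im w.im
    linarith
  rw [← integral_const_mul]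
  refine (hasDerivAt_integral_of_dominated_loc_of_deriv_le (μ := H)
    (F := fun (w : ℂ) (x : ℝ) => (w - (x : ℂ))⁻¹ ^ (n + 1))
    (F' := fun (w : ℂ) (x : ℝ) => -(n + 1) * (w - (x : ℂ))⁻¹ ^ (n + 2))
    (bound := fun _ => (n + 1) * (|z.im| / 2)⁻¹ ^ (n + 2)) (Metric.ball_mem_nhds z hc)
    (Filter.Eventually.of_forall fun w =>
      (measurable_inv_sub_ofReal_pow w (n + 1)).aestronglyMeasurable)
    (integrable_inv_sub_ofReal_pow H hz (n + 1))
    ((measurable_inv_sub_ofReal_pow z (n + 2)).const_mul _).aestronglyMeasurable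
    (Filter.Eventually.of_forall fun x w hw => ?_) (integrable_const _)
    (Filter.Eventually.of_forall fun x w hw => ?_)).2
  · rw [norm_mul, norm_neg]
    gcongr
    · exact le_of_eq (by exact_mod_cast Complex.norm_natCast (n + 1))
    · exact norm_inv_sub_ofReal_pow_le hc (him w hw) x _
  · have hw0 : w - (x : ℂ) ≠ 0 :=
      sub_ofReal_ne_zero (abs_pos.1 (hc.trans_le (him w hw))) x
    have := (((hasDerivAt_id w).sub_const (x : ℂ)).inv hw0).pow (n + 1)
    refine this.congr_deriv ?_
    simp only [id, Nat.add_sub_cancel, Pi.inv_apply]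
    push_cast
    rw [pow_add _ n 2]
    field_simp

theorem iteratedDeriv_stieltjes (H : Measure ℝ) [IsFiniteMeasure H] (n : ℕ) {z : ℂ}
    (hz : z.im ≠ 0) :
    iteratedDeriv n (stieltjes H) z =
      (-1) ^ n * (n.factorial : ℂ) * ∫ x : ℝ, (z - (x : ℂ))⁻¹ ^ (n + 1) ∂H := by
  induction n generalizing z with
  | zero => simp [stieltjes]
  | succ n ih =>
    have hev : iteratedDeriv n (stieltjes H) =ᶠ[nhds z] fun w =>
        (-1) ^ n * (n.factorial : ℂ) * ∫ x : ℝ, (w - (x : ℂ))⁻¹ ^ (n + 1) ∂H := by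
      filter_upwards [(isOpen_ne_fun Complex.continuous_im continuous_const).mem_nhds hz] with w hw
        using ih hw
    rw [iteratedDeriv_succ, hev.deriv_eq,
      ((hasDerivAt_integral_inv_sub_ofReal_pow H hz n).const_mul _).deriv, Nat.factorial_succ]
    push_cast
    ring

theorem normalized_iteratedDeriv_stieltjes (H : Measure ℝ) [IsFiniteMeasure H] (n : ℕ) {z : ℂ}
    (hz : z.im ≠ 0) :
    (-1 : ℂ) ^ n / (n.factorial : ℂ) * iteratedDeriv n (stieltjes H) z =
      ∫ x : ℝ, (z - (x : ℂ))⁻¹ ^ (n + 1) ∂H := by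
  rw [iteratedDeriv_stieltjes H n hz]
  have h1 : (n.factorial : ℂ) ≠ 0 := by exact_mod_cast n.factorial_ne_zero
  have h2 : ((-1 : ℂ) ^ n) * (-1) ^ n = 1 := by rw [← mul_pow]; simp
  calc _ = ((-1 : ℂ) ^ n * (-1) ^ n) * ((n.factorial : ℂ) / n.factorial) *
        ∫ x : ℝ, (z - (x : ℂ))⁻¹ ^ (n + 1) ∂H := by ring
    _ = _ := by rw [h2, div_self h1]; ring

theorem analyticAt_stieltjes (H : Measure ℝ) [IsFiniteMeasure H] {z : ℂ}
    (hz : z ∉ Complex.ofReal '' H.support) : AnalyticAt ℂ (stieltjes H) z := by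
  have hopen : IsOpen (Complex.ofReal '' H.support)ᶜ := by
    rw [isOpen_compl_iff]
    exact (Complex.isometry_ofReal.isClosedEmbedding.isClosed_iff_image_isClosed).1
      Measure.isClosed_support
  have h1 : AnalyticOn ℂ (resolventTransform H : ℂ → ℂ) (Complex.ofReal '' H.support)ᶜ :=
    analyticOn_resolventTransform
  have h2 : AnalyticAt ℂ (resolventTransform H : ℂ → ℂ) z :=
    (hopen.analyticOn_iff_analyticOnNhd.1 h1) z hz
  have h3 : stieltjes H = -(resolventTransform H : ℂ → ℂ) :=
    funext fun w => stieltjes_eq_neg_resolventTransform H w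
  rw [h3]
  exact h2.neg

theorem continuousAt_iteratedDeriv_stieltjes (H : Measure ℝ) [IsFiniteMeasure H] (n : ℕ) {z : ℂ}
    (hz : z ∉ Complex.ofReal '' H.support) :
    ContinuousAt (iteratedDeriv n (stieltjes H)) z := by
  rw [iteratedDeriv_eq_iterate]
  exact ((analyticAt_stieltjes H hz).iterated_deriv n).continuousAt

theorem eq_of_continuousAt_of_eq_off_real {f g : ℂ → ℂ} {z : ℂ} (hf : ContinuousAt f z)
    (hg : ContinuousAt g z) (hfg : ∀ w : ℂ, w.im ≠ 0 → f w = g w) : f z = g z := by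
  by_cases hz : z.im = 0
  · have ht : Filter.Tendsto (fun ε : ℝ => z + ε * Complex.I) (nhdsWithin 0 {0}ᶜ) (nhds z) := by
      have : ContinuousAt (fun ε : ℝ => z + ε * Complex.I) 0 := by fun_prop
      simpa using this.tendsto.mono_left nhdsWithin_le_nhds
    refine tendsto_nhds_unique_of_eventuallyEq (hf.tendsto.comp ht) (hg.tendsto.comp ht) ?_
    filter_upwards [self_mem_nhdsWithin] with ε hε
    refine hfg _ ?_
    simpa [hz] using hε
  · exact hfg z hz

/-- The sequence `0, u₀, …, u_{N-1}, 1, 1, …` obtained by padding a tuple. -/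
noncomputable def padded {N : ℕ} (u : Fin N → ℝ) (k : ℕ) : ℝ :=
  if k = 0 then 0 else if h : k - 1 < N then u ⟨k - 1, h⟩ else 1

/-- The open simplex `0 < u₀ < … < u_{N-1} < 1`. -/
def orderedSimplex (N : ℕ) : Set (Fin N → ℝ) :=
  {u | ∀ l ≤ N, padded u l < padded u (l + 1)}

/-- The average of `v` weighted by the consecutive spacings of a padded tuple. -/
noncomputable def spacingAverage {N : ℕ} (u : Fin N → ℝ) (v : ℕ → ℝ) : ℝ :=
  ∑ l ∈ Finset.range (N + 1), (padded u (l + 1) - padded u l) * v l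

@[simp] theorem padded_zero {N : ℕ} (u : Fin N → ℝ) : padded u 0 = 0 := by simp [padded]

theorem padded_of_lt {N : ℕ} (u : Fin N → ℝ) {k : ℕ} (hk : N < k) : padded u k = 1 := by
  rw [padded, if_neg (by omega), dif_neg (by omega)]

@[simp] theorem padded_fin_succ {N : ℕ} (u : Fin N → ℝ) (i : Fin N) :
    padded u (i + 1) = u i := by
  simp [padded]

theorem measurable_padded {N : ℕ} (k : ℕ) : Measurable fun u : Fin N → ℝ => padded u k := by
  unfold padded
  split_ifs <;> fun_prop

theorem measurable_spacingAverage {N : ℕ} (v : ℕ → ℝ) :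
    Measurable fun u : Fin N → ℝ => spacingAverage u v :=
  Finset.measurable_sum _ fun l _ =>
    ((measurable_padded (l + 1)).sub (measurable_padded l)).mul_const _

theorem measurableSet_orderedSimplex (N : ℕ) : MeasurableSet (orderedSimplex N) := by
  have : orderedSimplex N =
      ⋂ l : ℕ, ⋂ _ : l ≤ N, {u : Fin N → ℝ | padded u l < padded u (l + 1)} := by
    ext u; simp [orderedSimplex]
  rw [this]
  exact MeasurableSet.iInter fun l => MeasurableSet.iInter fun _ =>
    measurableSet_lt (measurable_padded l) (measurable_padded (l + 1))

theorem padded_lt_padded {N : ℕ} {u : Fin N → ℝ} (hu : u ∈ orderedSimplex N) {i j : ℕ}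
    (hij : i < j) (hj : j ≤ N + 1) : padded u i < padded u j := by
  induction j, hij using Nat.le_induction with
  | base => exact hu i (by omega)
  | succ j hij ih => exact (ih (by omega)).trans (hu j (by omega))

theorem strictMono_of_mem_orderedSimplex {N : ℕ} {u : Fin N → ℝ} (hu : u ∈ orderedSimplex N) :
    StrictMono u := by
  intro i j hij
  have hij' : (i : ℕ) < j := hij
  simpa using padded_lt_padded hu (i := i + 1) (j := j + 1) (by omega) (by omega)

theorem mem_Ioo_of_mem_orderedSimplex {N : ℕ} {u : Fin N → ℝ} (hu : u ∈ orderedSimplex N)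
    (i : Fin N) : u i ∈ Set.Ioo (0 : ℝ) 1 := by
  have h0 := padded_lt_padded hu (i := 0) (j := i + 1) (by omega) (by omega)
  have h1 := padded_lt_padded hu (i := i + 1) (j := N + 1) (by omega) le_rfl
  rw [padded_of_lt u (Nat.lt_succ_self N)] at h1
  simp only [padded_zero, padded_fin_succ] at h0 h1
  exact ⟨h0, h1⟩

theorem mem_orderedSimplex_of_strictMono {N : ℕ} {u : Fin N → ℝ} (hu : StrictMono u)
    (h01 : ∀ i, u i ∈ Set.Ioo (0 : ℝ) 1) : u ∈ orderedSimplex N := by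
  intro l hl
  rcases Nat.eq_zero_or_pos l with rfl | hpos
  · rw [padded_zero]
    rcases Nat.eq_zero_or_pos N with rfl | hN
    · rw [padded_of_lt u (by omega)]
      exact one_pos
    · simpa using (padded_fin_succ u ⟨0, hN⟩).symm ▸ (h01 ⟨0, hN⟩).1
  · have e1 : padded u l = u ⟨l - 1, by omega⟩ := by
      rw [padded, if_neg (by omega), dif_pos (by omega)]
    rw [e1]
    rcases hl.lt_or_eq with h | rfl
    · have e2 : padded u (l + 1) = u ⟨l, h⟩ := padded_fin_succ u ⟨l, h⟩
      rw [e2]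
      exact hu (Fin.mk_lt_mk.2 (by omega))
    · rw [padded_of_lt u (Nat.lt_succ_self _)]
      exact (h01 _).2

theorem volume_orderedSimplex_lt_top (N : ℕ) : volume (orderedSimplex N) < ⊤ := by
  refine (measure_mono (t := Set.Icc (0 : Fin N → ℝ) 1) fun u hu => ?_).trans_lt
    isCompact_Icc.measure_lt_top
  exact ⟨fun i => (mem_Ioo_of_mem_orderedSimplex hu i).1.le,
    fun i => (mem_Ioo_of_mem_orderedSimplex hu i).2.le⟩

theorem padded_snoc_smul {N : ℕ} (u : Fin N → ℝ) (t : ℝ) {l : ℕ} (hl : l ≤ N + 1) :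
    padded (Fin.snoc (α := fun _ => ℝ) (t • u) t) l = t * padded u l := by
  rcases Nat.eq_zero_or_pos l with rfl | hpos
  · simp
  obtain ⟨l, rfl⟩ : ∃ l', l = l' + 1 := ⟨l - 1, by omega⟩
  rcases (show l ≤ N by omega).lt_or_eq with h | rfl
  · have e1 := padded_fin_succ (Fin.snoc (α := fun _ => ℝ) (t • u) t) (Fin.castSucc ⟨l, h⟩)
    have e2 := padded_fin_succ u ⟨l, h⟩
    simp only [Fin.val_castSucc, Fin.snoc_castSucc] at e1 e2
    rw [e1, e2]
    simp
  · have e1 := padded_fin_succ (Fin.snoc (α := fun _ => ℝ) (t • u) t) (Fin.last l)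
    simp only [Fin.val_last, Fin.snoc_last] at e1
    rw [e1, padded_of_lt u (Nat.lt_succ_self l), mul_one]

theorem snoc_smul_mem_orderedSimplex {N : ℕ} {u : Fin N → ℝ} {t : ℝ} (ht : t ∈ Set.Ioo (0 : ℝ) 1) :
    Fin.snoc (α := fun _ => ℝ) (t • u) t ∈ orderedSimplex (N + 1) ↔ u ∈ orderedSimplex N := by
  constructor
  · intro h l hl
    have := h l (by omega)
    rw [padded_snoc_smul u t (by omega), padded_snoc_smul u t (by omega)] at this
    exact lt_of_mul_lt_mul_left this ht.1.le
  · intro h l hl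
    rcases hl.lt_or_eq with hl | rfl
    · rw [padded_snoc_smul u t (by omega), padded_snoc_smul u t (by omega)]
      exact mul_lt_mul_of_pos_left (h l (by omega)) ht.1
    · rw [padded_snoc_smul u t le_rfl, padded_of_lt _ (Nat.lt_succ_self (N + 1)),
        padded_of_lt u (Nat.lt_succ_self N), mul_one]
      exact ht.2

theorem spacingAverage_snoc_smul {N : ℕ} (u : Fin N → ℝ) (t : ℝ) (v : ℕ → ℝ) :
    spacingAverage (Fin.snoc (α := fun _ => ℝ) (t • u) t) v =
      t * spacingAverage u v + (1 - t) * v (N + 1) := by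
  rw [spacingAverage, Finset.sum_range_succ, padded_snoc_smul u t le_rfl,
    padded_of_lt _ (Nat.lt_succ_self (N + 1)), padded_of_lt u (Nat.lt_succ_self N), mul_one,
    spacingAverage, Finset.mul_sum]
  congr 1
  refine Finset.sum_congr rfl fun l hl => ?_
  rw [Finset.mem_range] at hl
  rw [padded_snoc_smul u t (by omega), padded_snoc_smul u t (by omega)]
  ring

theorem integral_pow_mul_inv_segment_pow {z : ℂ} (hz : z.im ≠ 0) (a b : ℝ) (N : ℕ) :
    ∫ t in Set.Ioo (0 : ℝ) 1, (t : ℂ) ^ N * (z - ((t * a + (1 - t) * b : ℝ) : ℂ))⁻¹ ^ (N + 2) =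
      (N + 1 : ℂ)⁻¹ * (z - (a : ℂ))⁻¹ ^ (N + 1) * (z - (b : ℂ))⁻¹ := by
  have hb := sub_ofReal_ne_zero hz b
  have hN : (N + 1 : ℂ) ≠ 0 := by exact_mod_cast N.succ_ne_zero
  rw [← integral_Ioc_eq_integral_Ioo, ← intervalIntegral.integral_of_le zero_le_one]
  have hD : ∀ t : ℝ, HasDerivAt (fun t : ℝ => z - ((t * a + (1 - t) * b : ℝ) : ℂ))
      (-((a - b : ℝ) : ℂ)) t := by
    intro t
    have : HasDerivAt (fun t : ℝ => t * a + (1 - t) * b) (a - b) t := by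
      refine (((hasDerivAt_id t).mul_const a).add
        (((hasDerivAt_id t).const_sub 1).mul_const b)).congr_deriv ?_
      ring
    exact this.ofReal_comp.const_sub z
  have hderiv : ∀ t : ℝ, HasDerivAt
      (fun t : ℝ => ((N + 1 : ℂ)⁻¹ * (z - (b : ℂ))⁻¹) *
        ((t : ℂ) ^ (N + 1) * (z - ((t * a + (1 - t) * b : ℝ) : ℂ))⁻¹ ^ (N + 1)))
      ((t : ℂ) ^ N * (z - ((t * a + (1 - t) * b : ℝ) : ℂ))⁻¹ ^ (N + 2)) t := by
    intro t
    have h0 := sub_ofReal_ne_zero hz (t * a + (1 - t) * b)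
    have h1 := ((hasDerivAt_id t).ofReal_comp.pow (N + 1)).mul (((hD t).inv h0).pow (N + 1))
    refine (h1.const_mul ((N + 1 : ℂ)⁻¹ * (z - (b : ℂ))⁻¹)).congr_deriv ?_
    simp only [Nat.add_sub_cancel, Pi.inv_apply, Pi.pow_apply, id]
    have h2 : z - ((t * a + (1 - t) * b : ℝ) : ℂ) ≠ 0 := h0
    have h3 : z - ((t * a + (1 - t) * b : ℝ) : ℂ) =
      (z - (b : ℂ)) - t * ((a - b : ℝ) : ℂ) := by push_cast; ring
    generalize z - ((t * a + (1 - t) * b : ℝ) : ℂ) = D at h2 h3 ⊢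
    generalize z - (b : ℂ) = q at hb h3 ⊢
    generalize ((a - b : ℝ) : ℂ) = e at h3 ⊢
    have hq : q = D + t * e := by rw [h3]; ring
    push_cast
    simp only [inv_pow]
    field_simp
    rw [hq]
    ring
  rw [intervalIntegral.integral_eq_sub_of_hasDerivAt (fun t _ => hderiv t)]
  · simp
    ring
  · refine Continuous.intervalIntegrable ?_ _ _
    refine (Complex.continuous_ofReal.pow N).mul (Continuous.pow (Continuous.inv₀ ?_ fun t =>
      sub_ofReal_ne_zero hz _) _)
    fun_prop

theorem setIntegral_orderedSimplex_succ {N : ℕ} {g : (Fin (N + 1) → ℝ) → ℂ}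
    (hg : IntegrableOn g (orderedSimplex (N + 1))) :
    ∫ u in orderedSimplex (N + 1), g u =
      ∫ t in Set.Ioo (0 : ℝ) 1, ∫ u in orderedSimplex N,
        (t : ℂ) ^ N * g (Fin.snoc (α := fun _ => ℝ) (t • u) t) := by
  set G := (orderedSimplex (N + 1)).indicator g with hG_def
  have hmp := (volume_preserving_piFinSuccAbove (fun _ : Fin (N + 1) => ℝ) (Fin.last N)).symm
  have hG : Integrable G := (integrable_indicator_iff (measurableSet_orderedSimplex _)).2 hg
  rw [← integral_indicator (measurableSet_orderedSimplex _), ← hmp.integral_comp',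
    Measure.volume_eq_prod,
    integral_prod (fun p => G ((MeasurableEquiv.piFinSuccAbove (fun _ => ℝ) (Fin.last N)).symm p))
      (hmp.integrable_comp_of_integrable hG),
    ← integral_indicator measurableSet_Ioo]
  congr 1 with t
  have hsnoc : ∀ u : Fin N → ℝ, (MeasurableEquiv.piFinSuccAbove (fun _ => ℝ) (Fin.last N)).symm
      (t, u) = Fin.snoc (α := fun _ => ℝ) u t := by
    intro u
    simp only [MeasurableEquiv.piFinSuccAbove_symm_apply, Fin.insertNthEquiv_last]
    rfl
  simp_rw [hsnoc]
  by_cases ht : t ∈ Set.Ioo (0 : ℝ) 1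
  · rw [Set.indicator_of_mem ht, ← integral_indicator (measurableSet_orderedSimplex _)]
    have hs := Measure.integral_comp_smul (volume : Measure (Fin N → ℝ))
      (fun u => G (Fin.snoc (α := fun _ => ℝ) u t)) t
    rw [Module.finrank_fin_fun, abs_of_pos (inv_pos.2 (pow_pos ht.1 N))] at hs
    have hs' : ∫ u : Fin N → ℝ, G (Fin.snoc (α := fun _ => ℝ) u t) =
        (t : ℂ) ^ N * ∫ u : Fin N → ℝ, G (Fin.snoc (α := fun _ => ℝ) (t • u) t) := by
      rw [hs, Complex.real_smul, ← mul_assoc]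
      push_cast
      rw [mul_inv_cancel₀ (pow_ne_zero _ (Complex.ofReal_ne_zero.2 ht.1.ne')), one_mul]
    refine hs'.trans ?_
    rw [← integral_const_mul]
    congr 1 with u
    by_cases hu : u ∈ orderedSimplex N
    · rw [Set.indicator_of_mem hu, hG_def, Set.indicator_of_mem ((snoc_smul_mem_orderedSimplex ht).2 hu)]
    · rw [Set.indicator_of_notMem hu, hG_def,
        Set.indicator_of_notMem (mt (snoc_smul_mem_orderedSimplex ht).1 hu), mul_zero]
  · rw [Set.indicator_of_notMem ht]
    refine integral_eq_zero_of_ae (Filter.Eventually.of_forall fun u => ?_)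
    refine Set.indicator_of_notMem (fun hu => ht ?_) _
    simpa using mem_Ioo_of_mem_orderedSimplex hu (Fin.last N)

theorem setIntegral_orderedSimplex_inv_sub_spacingAverage_pow {z : ℂ} (hz : z.im ≠ 0)
    (v : ℕ → ℝ) (N : ℕ) :
    ∫ u in orderedSimplex N, (z - (spacingAverage u v : ℂ))⁻¹ ^ (N + 1) =
      (N.factorial : ℂ)⁻¹ * ∏ l ∈ Finset.range (N + 1), (z - (v l : ℂ))⁻¹ := by
  induction N with
  | zero =>
    have h : orderedSimplex 0 = Set.univ := by
      refine Set.eq_univ_of_forall fun u => ?_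
      exact mem_orderedSimplex_of_strictMono (fun i => i.elim0) fun i => i.elim0
    rw [h, setIntegral_univ, volume_pi, Measure.pi_of_empty _ default, integral_dirac]
    simp [spacingAverage, padded]
  | succ N ih =>
    have : IsFiniteMeasure (volume.restrict (orderedSimplex N)) :=
      isFiniteMeasure_restrict.2 (volume_orderedSimplex_lt_top N).ne
    have : IsFiniteMeasure (volume.restrict (orderedSimplex (N + 1))) :=
      isFiniteMeasure_restrict.2 (volume_orderedSimplex_lt_top (N + 1)).ne
    rw [setIntegral_orderedSimplex_succ]
    · simp_rw [spacingAverage_snoc_smul]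
      rw [integral_integral_swap]
      · simp_rw [integral_pow_mul_inv_segment_pow hz]
        rw [integral_mul_const, integral_const_mul, ih, Finset.prod_range_succ _ (N + 1),
          Nat.factorial_succ]
        push_cast
        rw [mul_inv]
        ring
      · refine Integrable.of_bound (C := 1 * |z.im|⁻¹ ^ (N + 2)) ?_ ?_
        · refine Measurable.aestronglyMeasurable ?_
          have := (measurable_spacingAverage (N := N) v).comp
            (measurable_snd : Measurable (Prod.snd : ℝ × (Fin N → ℝ) → _))
          simp only [Function.comp_def] at this
          simp only [Function.uncurry_def]
          fun_prop
        · rw [Measure.prod_restrict]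
          filter_upwards [ae_restrict_mem (measurableSet_Ioo.prod (measurableSet_orderedSimplex N))]
            with p hp
          simp only [Function.uncurry_def]
          rw [norm_mul]
          gcongr
          · rw [norm_pow, Complex.norm_real, Real.norm_of_nonneg hp.1.1.le]
            exact pow_le_one₀ hp.1.1.le hp.1.2.le
          · exact norm_inv_sub_ofReal_pow_le (abs_pos.2 hz) le_rfl _ _
    · refine Integrable.of_bound (C := |z.im|⁻¹ ^ (N + 2)) ?_
        (Filter.Eventually.of_forall fun u =>
          norm_inv_sub_ofReal_pow_le (abs_pos.2 hz) le_rfl _ _)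
      exact ((measurable_inv_sub_ofReal_pow z _).comp
        (measurable_spacingAverage v)).aestronglyMeasurable

theorem volume_setOf_apply_eq_apply {N : ℕ} {i j : Fin N} (hij : i ≠ j) :
    volume {u : Fin N → ℝ | u i = u j} = 0 := by
  let L : (Fin N → ℝ) →ₗ[ℝ] ℝ := (LinearMap.proj i : (Fin N → ℝ) →ₗ[ℝ] ℝ) - LinearMap.proj j
  have hL : {u : Fin N → ℝ | u i = u j} = (LinearMap.ker L : Set (Fin N → ℝ)) := by
    ext u
    simp [L, sub_eq_zero]
  rw [hL]
  refine Measure.addHaar_submodule _ _ fun htop => ?_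
  have : L (Pi.single i 1) = 0 := by
    rw [← LinearMap.mem_ker, htop]
    trivial
  simp [L, hij.symm] at this

theorem ae_injective (N : ℕ) : ∀ᵐ u : Fin N → ℝ, Function.Injective u := by
  have h : ∀ᵐ u : Fin N → ℝ, ∀ p : Fin N × Fin N, p.1 ≠ p.2 → u p.1 ≠ u p.2 := by
    rw [ae_all_iff]
    intro p
    by_cases hp : p.1 = p.2
    · simp [hp]
    · have := measure_eq_zero_iff_ae_notMem.1 (volume_setOf_apply_eq_apply hp)
      filter_upwards [this] with u hu _ using hu
  filter_upwards [h] with u hu i j hij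
  by_contra hne
  exact hu (i, j) hne hij

theorem Icc_ae_eq_iUnion_orderedSimplex (N : ℕ) :
    (Set.Icc 0 1 : Set (Fin N → ℝ)) =ᵐ[volume]
      ⋃ σ : Equiv.Perm (Fin N), {u : Fin N → ℝ | u ∘ σ ∈ orderedSimplex N} := by
  refine (Measure.univ_pi_Ioo_ae_eq_Icc (μ := fun _ : Fin N => (volume : Measure ℝ))
    (f := 0) (g := 1)).symm.trans ?_
  filter_upwards [ae_injective N] with u hu
  refine propext ⟨fun h => ?_, fun h => ?_⟩
  · refine Set.mem_iUnion.2 ⟨Tuple.sort u, mem_orderedSimplex_of_strictMono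
      ((Tuple.monotone_sort u).strictMono_of_injective (hu.comp (Tuple.sort u).injective))
      fun i => h _ trivial⟩
  · obtain ⟨σ, hσ⟩ := Set.mem_iUnion.1 h
    intro i _
    simpa using mem_Ioo_of_mem_orderedSimplex hσ (σ.symm i)

theorem pairwise_disjoint_perm_orderedSimplex (N : ℕ) :
    Pairwise (Function.onFun Disjoint fun σ : Equiv.Perm (Fin N) =>
      {u : Fin N → ℝ | u ∘ σ ∈ orderedSimplex N}) := by
  intro σ τ hne
  refine Set.disjoint_left.2 fun u hσ hτ => hne ?_
  have h1 := strictMono_of_mem_orderedSimplex hσ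
  have h2 := strictMono_of_mem_orderedSimplex hτ
  have h3 := Tuple.unique_monotone h1.monotone h2.monotone
  have hinj : Function.Injective u := by
    simpa [Function.comp_assoc] using h1.injective.comp σ.symm.injective
  exact Equiv.ext fun i => hinj (congrFun h3 i)

theorem setIntegral_Icc_comp_sort {N : ℕ} {f : (Fin N → ℝ) → ℂ}
    (hf : IntegrableOn (fun u => f (u ∘ Tuple.sort u)) (Set.Icc 0 1)) :
    ∫ u in Set.Icc 0 1, f (u ∘ Tuple.sort u) =
      (N.factorial : ℂ) * ∫ u in orderedSimplex N, f u := by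
  have hmp : ∀ σ : Equiv.Perm (Fin N),
      MeasurePreserving (MeasurableEquiv.piCongrLeft (fun _ : Fin N => ℝ) σ.symm) := fun σ =>
    volume_measurePreserving_piCongrLeft (fun _ => ℝ) σ.symm
  have happ : ∀ (σ : Equiv.Perm (Fin N)) (u : Fin N → ℝ),
      MeasurableEquiv.piCongrLeft (fun _ : Fin N => ℝ) σ.symm u = u ∘ σ := by
    intro σ u
    ext i
    have := Equiv.piCongrLeft_apply_apply (P := fun _ : Fin N => ℝ) σ.symm u (σ i)
    rwa [Equiv.symm_apply_apply] at this
  have hpre : ∀ σ : Equiv.Perm (Fin N), {u : Fin N → ℝ | u ∘ σ ∈ orderedSimplex N} =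
      MeasurableEquiv.piCongrLeft (fun _ : Fin N => ℝ) σ.symm ⁻¹' orderedSimplex N := by
    intro σ
    ext u
    rw [Set.mem_preimage, happ]
    rfl
  have hmeas : ∀ σ : Equiv.Perm (Fin N),
      MeasurableSet {u : Fin N → ℝ | u ∘ σ ∈ orderedSimplex N} := by
    intro σ
    rw [hpre]
    exact (MeasurableEquiv.measurable _) (measurableSet_orderedSimplex N)
  have hae := Icc_ae_eq_iUnion_orderedSimplex N
  rw [setIntegral_congr_set hae, integral_iUnion_fintype hmeas
    (pairwise_disjoint_perm_orderedSimplex N) fun σ =>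
      (hf.congr_set_ae hae.symm).mono_set
        (Set.subset_iUnion (fun σ : Equiv.Perm (Fin N) => {u | u ∘ σ ∈ orderedSimplex N}) σ)]
  have hpiece : ∀ σ : Equiv.Perm (Fin N),
      ∫ u in {u : Fin N → ℝ | u ∘ σ ∈ orderedSimplex N}, f (u ∘ Tuple.sort u) =
        ∫ u in orderedSimplex N, f u := by
    intro σ
    rw [← (hmp σ).setIntegral_preimage_emb (MeasurableEquiv.measurableEmbedding _) f
      (orderedSimplex N), ← hpre]
    refine setIntegral_congr_fun (hmeas σ) fun u hu => ?_
    simp only [happ]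
    rw [Tuple.comp_sort_eq_comp_iff_monotone.2 (strictMono_of_mem_orderedSimplex hu).monotone]
  simp_rw [hpiece]
  simp [Fintype.card_perm]

@[to_additive]
theorem prod_range_last_eq_prod_prod_Ico {β : Type*} [CommMonoid β] (f : ℕ → β) {n : ℕ}
    {k : Fin (n + 1) → ℕ} (hk : Monotone k) (hk0 : k 0 = 0) :
    ∏ l ∈ Finset.range (k (Fin.last n)), f l =
      ∏ j : Fin n, ∏ l ∈ Finset.Ico (k j.castSucc) (k j.succ), f l := by
  induction n with
  | zero =>
    rw [show Fin.last 0 = 0 from rfl, hk0]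
    simp
  | succ n ih =>
    have h := ih (k := fun i => k i.castSucc) (fun a b hab => hk (by simpa using hab))
      (by simpa using hk0)
    rw [Fin.prod_univ_castSucc]
    simp only [Fin.succ_last, ← Fin.castSucc_succ] at h ⊢
    rw [← h, Finset.prod_range_mul_prod_Ico _ (hk (Fin.le_last _))]

theorem exists_eq_on_Ico {n : ℕ} {k : Fin (n + 1) → ℕ} (hk : Monotone k) (x : Fin n → ℝ) :
    ∃ v : ℕ → ℝ, ∀ j : Fin n, ∀ l ∈ Finset.Ico (k j.castSucc) (k j.succ), v l = x j := by
  have hlt : ∀ i j : Fin n, i < j → ∀ l, l < k i.succ → k j.castSucc ≤ l → False := by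
    intro i j hij l h1 h2
    have : k i.succ ≤ k j.castSucc := hk (Fin.succ_le_castSucc_iff.2 hij)
    omega
  refine ⟨fun l => ∑ j : Fin n,
    if l ∈ Finset.Ico (k j.castSucc) (k j.succ) then x j else 0, fun j l hl => ?_⟩
  have hl' := Finset.mem_Ico.1 hl
  dsimp only
  rw [Finset.sum_eq_single j, if_pos hl]
  · intro i _ hij
    rw [if_neg]
    intro hi
    have hi' := Finset.mem_Ico.1 hi
    rcases lt_or_gt_of_ne hij with h | h
    · exact hlt i j h l hi'.2 hl'.1
    · exact hlt j i h l hl'.2 hi'.1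
  · simp

theorem weightedAverage_eq_spacingAverage {N n : ℕ} (u : Fin N → ℝ) {k : Fin (n + 1) → ℕ}
    (hk : Monotone k) (hk0 : k 0 = 0) (hkn : k (Fin.last n) = N + 1) {x : Fin n → ℝ} {v : ℕ → ℝ}
    (hv : ∀ j : Fin n, ∀ l ∈ Finset.Ico (k j.castSucc) (k j.succ), v l = x j) :
    weightedAverage u k x = spacingAverage (u ∘ Tuple.sort u) v := by
  rw [spacingAverage, ← hkn, sum_range_last_eq_sum_sum_Ico _ hk hk0, weightedAverage]
  refine Finset.sum_congr rfl fun j _ => ?_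
  rw [Finset.sum_congr rfl fun l hl => by rw [hv j l hl], ← Finset.sum_mul,
    Finset.sum_Ico_sub _ (hk (Fin.castSucc_le_succ j))]
  rfl

theorem measurable_uncurry_weightedAverage {N n : ℕ} (k : Fin (n + 1) → ℕ) :
    Measurable fun p : (Fin n → ℝ) × (Fin N → ℝ) => weightedAverage p.2 k p.1 :=
  measurable_weightedAverage (U := fun j (p : (Fin n → ℝ) × (Fin N → ℝ)) => p.2 j)
    (X := fun i p => p.1 i) (fun j => by fun_prop) (fun i => by fun_prop) k

theorem setIntegral_Icc_inv_sub_weightedAverage_pow {z : ℂ} (hz : z.im ≠ 0) {N n : ℕ}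
    {k : Fin (n + 1) → ℕ} (hk : Monotone k) (hk0 : k 0 = 0) (hkn : k (Fin.last n) = N + 1)
    (x : Fin n → ℝ) :
    ∫ u in (Set.Icc 0 1 : Set (Fin N → ℝ)), (z - (weightedAverage u k x : ℂ))⁻¹ ^ (N + 1) =
      ∏ j, (z - (x j : ℂ))⁻¹ ^ (k j.succ - k j.castSucc) := by
  obtain ⟨v, hv⟩ := exists_eq_on_Ico hk x
  have hint : IntegrableOn (fun u : Fin N → ℝ => (z - (weightedAverage u k x : ℂ))⁻¹ ^ (N + 1))
      (Set.Icc 0 1) := by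
    have : IsFiniteMeasure (volume.restrict (Set.Icc 0 1 : Set (Fin N → ℝ))) :=
      isFiniteMeasure_restrict.2 isCompact_Icc.measure_lt_top.ne
    refine Integrable.of_bound (C := |z.im|⁻¹ ^ (N + 1)) ?_ (Filter.Eventually.of_forall fun u =>
      norm_inv_sub_ofReal_pow_le (abs_pos.2 hz) le_rfl _ _)
    exact ((measurable_inv_sub_ofReal_pow z _).comp ((measurable_uncurry_weightedAverage k).comp
      measurable_prodMk_left)).aestronglyMeasurable
  simp_rw [weightedAverage_eq_spacingAverage _ hk hk0 hkn hv] at hint ⊢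
  rw [setIntegral_Icc_comp_sort (f := fun u => (z - (spacingAverage u v : ℂ))⁻¹ ^ (N + 1)) hint,
    setIntegral_orderedSimplex_inv_sub_spacingAverage_pow hz, ← mul_assoc,
    mul_inv_cancel₀ (by exact_mod_cast N.factorial_ne_zero), one_mul, ← hkn,
    prod_range_last_eq_prod_prod_Ico _ hk hk0]
  refine Finset.prod_congr rfl fun j _ => ?_
  rw [Finset.prod_congr rfl fun l hl => by rw [hv j l hl], Finset.prod_const, Nat.card_Ico]

theorem map_eq_volume_restrict_Icc {Ω : Type*} [MeasurableSpace Ω] {P : Measure Ω} {N : ℕ}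
    {U : Fin N → Ω → ℝ} (hU : ∀ j, Measurable (U j)) (hUindep : iIndepFun U P)
    (hUunif : ∀ j, pdf.IsUniform (U j) (Set.Icc 0 1) P volume) :
    P.map (fun ω j => U j ω) = volume.restrict (Set.Icc 0 1) := by
  have hU1 : ∀ j, P.map (U j) = volume.restrict (Set.Icc 0 1) := by
    intro j
    rw [hUunif j, ProbabilityTheory.cond]
    simp
  rw [hUindep.map_fun_eq_pi_map fun j => (hU j).aemeasurable]
  simp_rw [hU1]
  rw [← Set.pi_univ_Icc, volume_pi, Measure.restrict_pi_pi]
  rfl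

theorem integral_inv_sub_map_weightedAverage_pow {Ω : Type*} [MeasurableSpace Ω] {P : Measure Ω}
    [IsProbabilityMeasure P] {n N : ℕ} {k : Fin (n + 1) → ℕ} (hk : Monotone k) (hk0 : k 0 = 0)
    (hkn : k (Fin.last n) = N + 1) {X : Fin n → Ω → ℝ} (hX : ∀ i, Measurable (X i))
    (hXindep : iIndepFun X P) {U : Fin N → Ω → ℝ} (hU : ∀ j, Measurable (U j))
    (hUindep : iIndepFun U P) (hUunif : ∀ j, pdf.IsUniform (U j) (Set.Icc 0 1) P volume)
    (hXU : IndepFun (fun ω i => X i ω) (fun ω j => U j ω) P) {z : ℂ} (hz : z.im ≠ 0) :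
    ∫ s : ℝ, (z - (s : ℂ))⁻¹ ^ (N + 1)
        ∂(P.map fun ω => weightedAverage (fun j => U j ω) k (fun i => X i ω)) =
      ∏ i, ∫ s : ℝ, (z - (s : ℂ))⁻¹ ^ (k i.succ - k i.castSucc) ∂(P.map (X i)) := by
  have hX' : Measurable fun ω i => X i ω := measurable_pi_lambda _ hX
  have hU' : Measurable fun ω j => U j ω := measurable_pi_lambda _ hU
  have hW := measurable_uncurry_weightedAverage (N := N) k
  have hlaw := hXU.map_prod_eq_prod_map_map hX'.aemeasurable hU'.aemeasurable
  have hprobX : IsProbabilityMeasure (P.map fun ω i => X i ω) :=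
    Measure.isProbabilityMeasure_map hX'.aemeasurable
  have hprobU : IsProbabilityMeasure (P.map fun ω j => U j ω) :=
    Measure.isProbabilityMeasure_map hU'.aemeasurable
  have hprob : ∀ i, IsProbabilityMeasure (P.map (X i)) := fun i =>
    Measure.isProbabilityMeasure_map (hX i).aemeasurable
  have hcomp : (P.map fun ω => weightedAverage (fun j => U j ω) k (fun i => X i ω)) =
      ((P.map fun ω i => X i ω).prod (P.map fun ω j => U j ω)).map
        fun p => weightedAverage p.2 k p.1 := by
    rw [← hlaw, Measure.map_map hW (hX'.prodMk hU')]
    rfl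
  have hgm : Measurable fun p : (Fin n → ℝ) × (Fin N → ℝ) =>
      (z - (weightedAverage p.2 k p.1 : ℂ))⁻¹ ^ (N + 1) :=
    (measurable_inv_sub_ofReal_pow z _).comp hW
  rw [hcomp, integral_map hW.aemeasurable (measurable_inv_sub_ofReal_pow z _).aestronglyMeasurable,
    integral_prod]
  · rw [map_eq_volume_restrict_Icc hU hUindep hUunif]
    simp_rw [setIntegral_Icc_inv_sub_weightedAverage_pow hz hk hk0 hkn]
    rw [hXindep.map_fun_eq_pi_map fun i => (hX i).aemeasurable]
    exact integral_fintype_prod_eq_prod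
      (fun (i : Fin n) (s : ℝ) => (z - (s : ℂ))⁻¹ ^ (k i.succ - k i.castSucc))
  · exact Integrable.of_bound hgm.aestronglyMeasurable _ (Filter.Eventually.of_forall fun p =>
      norm_inv_sub_ofReal_pow_le (abs_pos.2 hz) le_rfl _ _)

theorem theorem1 {Ω : Type*} [MeasurableSpace Ω] (P : Measure Ω) [IsProbabilityMeasure P]
    (n N : ℕ) (hn : 1 ≤ n)
    -- the indices `0 = k_0 < k_1 < … < k_n = N`, where `N` stands for `n*`
    (k : Fin (n + 1) → ℕ) (hk : StrictMono k) (hk0 : k 0 = 0) (hkn : k (Fin.last n) = N)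
    -- the multiplicities `m_i = k_i - k_{i-1}`
    (m : Fin n → ℕ) (hm : ∀ i, m i = k i.succ - k i.castSucc)
    -- independent continuous random variables
    (X : Fin n → Ω → ℝ) (hX : ∀ i, Measurable (X i)) (hXindep : iIndepFun X P)
    (hXcont : ∀ i, ∀ x : ℝ, P.map (X i) {x} = 0)
    -- a uniform sample of size `n* - 1`, independent of the `X`'s
    (U : Fin (N - 1) → Ω → ℝ) (hU : ∀ j, Measurable (U j)) (hUindep : iIndepFun U P)
    (hUunif : ∀ j, pdf.IsUniform (U j) (Set.Icc 0 1) P volume)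
    (hXU : IndepFun (fun ω i => X i ω) (fun ω j => U j ω) P)
    -- the law of the randomly weighted average
    (F : Measure ℝ)
    (hF : F = P.map (fun ω => weightedAverage (fun j => U j ω) k (fun i => X i ω)))
    (z : ℂ) (hz : ∀ i, z ∉ Complex.ofReal '' (P.map (X i)).support)
    -- `S(F, ·)` is defined at `z`
    (hzF : z ∉ Complex.ofReal '' F.support) :
    (-1 : ℂ) ^ (N - 1) / ((N - 1).factorial : ℂ) * iteratedDeriv (N - 1) (stieltjes F) z =
      ∏ i, (-1 : ℂ) ^ (m i - 1) / ((m i - 1).factorial : ℂ) *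
        iteratedDeriv (m i - 1) (stieltjes (P.map (X i))) z := by

  have hNpos : N - 1 + 1 = N := by
    have : k 0 < k (Fin.last n) := hk (by simp only [Fin.lt_def, Fin.val_last]; exact hn)
    omega
  have hmpos : ∀ i, m i - 1 + 1 = k i.succ - k i.castSucc := by
    intro i
    have := hk (Fin.castSucc_lt_succ (i := i))
    rw [hm]
    omega
  have hFprob : IsProbabilityMeasure F := by
    rw [hF]
    exact Measure.isProbabilityMeasure_map (measurable_weightedAverage hU hX k).aemeasurable
  have hXprob : ∀ i, IsProbabilityMeasure (P.map (X i)) := fun i =>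
    Measure.isProbabilityMeasure_map (hX i).aemeasurable
  refine eq_of_continuousAt_of_eq_off_real
    (f := fun w => (-1 : ℂ) ^ (N - 1) / ((N - 1).factorial : ℂ) *
      iteratedDeriv (N - 1) (stieltjes F) w)
    (g := fun w => ∏ i, (-1 : ℂ) ^ (m i - 1) / ((m i - 1).factorial : ℂ) *
      iteratedDeriv (m i - 1) (stieltjes (P.map (X i))) w)
    (continuousAt_const.mul (continuousAt_iteratedDeriv_stieltjes F _ hzF))
    (tendsto_finsetProd _ fun i _ =>
      continuousAt_const.mul (continuousAt_iteratedDeriv_stieltjes _ _ (hz i)))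
    fun w hw => ?_
  simp only [normalized_iteratedDeriv_stieltjes _ _ hw, hmpos]
  rw [hF]
  exact integral_inv_sub_map_weightedAverage_pow hk.monotone hk0 (hkn.trans hNpos.symm) hX hXindep
    hU hUindep hUunif hXU hw
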